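/- Let $n\ge 1$ and let $\mathrm{NDF}_n$ be the monoid, under composition, of non-decreasing functions from $\{1,\dots,n\}$ to itself. It acts on $\mathbb{C}^n$ (with canonical basis $e_1,\dots,e_n$) by sending $e_i$ to $e_{f(i)}$, and diagonally on the exterior powers of $\mathbb{C}^n$; for $0\le k\le n$ let $P_n^k=\bigwedge^k\mathbb{C}^n$ be the resulting $\mathbb{C}[\mathrm{NDF}_n]$-module. (For $f,g\in\mathrm{NDF}_n$, the product which acts on $P_n^k$ as "first $f$, then $g$" is $g\circ f$; modules are taken on the side for which this is an action.) For $1\le k\le n$ let $\delta:P_n^k\to P_n^{k-1}$ be the morphism of $\mathbb{C}[\mathrm{NDF}_n]$-modules given by $$\delta(e_{s_1}\wedge\dots\wedge e_{s_k})=\sum_{i=1}^k(-1)^{k-i}\,e_{s_1}\wedge\dots\wedge\widehat{e_{s_i}}\wedge\dots\wedge e_{s_k}\qquad(s_1<\dots<s_k),$$ and let $S_n^k=P_n^k/\ker\delta$. Then: 1. The modules $(P_n^k)_{k=1,\dots,n}$ form a complete set of representatives of the isomorphism classes of indecomposable projective $\mathbb{C}[\mathrm{NDF}_n]$-modules: each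 is indecomposable and projective, they are pairwise non-isomorphic, and every indecomposable projective module is isomorphic to one of them. 2. The modules $(S_n^k)_{k=1,\dots,n}$ form a complete set of representatives of the isomorphism classes of simple $\mathbb{C}[\mathrm{NDF}_n]$-modules: each is simple, they are pairwise non-isomorphic, and every simple module is isomorphic to one of them. 3. For all $k,l\in\{1,\dots,n\}$, $$\dim_{\mathbb{C}}\operatorname{Hom}_{\mathbb{C}[\mathrm{NDF}_n]}(P_n^k,P_n^l)=\begin{cases}1&\text{if } l\in\{k,k-1\},\\ 0&\text{otherwise.}\end{cases}$$ -/

import Mathlib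

universe u

/-- The monoid of non-decreasing functions from an `n`-element chain to itself; multiplication is
composition, `(f * g) x = f (g x)`. -/
abbrev NDF (n : ℕ) : Type := Fin n →o Fin n

/-- The monoid algebra `ℂ[NDF_n]`. -/
noncomputable abbrev NDFAlgebra (n : ℕ) : Type := MonoidAlgebra ℂ (NDF n)

namespace NDF

/-- The linear endomorphism of `ℂⁿ` sending the basis vector `e_i` to `e_{f i}`. -/
noncomputable def naturalMap (n : ℕ) (f : NDF n) : (Fin n → ℂ) →ₗ[ℂ] (Fin n → ℂ) :=
  (Pi.basisFun ℂ (Fin n)).constr ℂ fun i => Pi.single (f i) 1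

theorem naturalMap_single (n : ℕ) (f : NDF n) (i : Fin n) :
    naturalMap n f (Pi.single i 1) = Pi.single (f i) 1 := by
  rw [← Pi.basisFun_apply, naturalMap, Module.Basis.constr_basis]

/-- The natural representation of `NDF_n` on `ℂⁿ`. -/
noncomputable def natural (n : ℕ) : Representation ℂ (NDF n) (Fin n → ℂ) where
  toFun := naturalMap n
  map_one' := (Pi.basisFun ℂ (Fin n)).ext fun i => by
    rw [Pi.basisFun_apply, naturalMap_single]; rfl
  map_mul' f g := (Pi.basisFun ℂ (Fin n)).ext fun i => by
    rw [Pi.basisFun_apply, Module.End.mul_apply, naturalMap_single, naturalMap_single,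
      naturalMap_single]; rfl

theorem exterior_map_one (n k : ℕ) :
    exteriorPower.map k (natural n 1) = LinearMap.id := by
  rw [map_one, Module.End.one_eq_id, exteriorPower.map_id]

theorem exterior_map_mul (n k : ℕ) (f g : NDF n) :
    exteriorPower.map k (natural n (f * g)) =
      exteriorPower.map k (natural n f) ∘ₗ exteriorPower.map k (natural n g) := by
  rw [map_mul, Module.End.mul_eq_comp, exteriorPower.map_comp]

/-- The diagonal action of `NDF_n` on the exterior power `⋀ᵏ ℂⁿ`:
`f • (x₁ ∧ ⋯ ∧ xₖ) = (f • x₁) ∧ ⋯ ∧ (f • xₖ)`. -/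
noncomputable def exterior (n k : ℕ) : Representation ℂ (NDF n) (⋀[ℂ]^k (Fin n → ℂ)) where
  toFun f := exteriorPower.map k (natural n f)
  map_one' := exterior_map_one n k
  map_mul' f g := exterior_map_mul n k f g

/-- The `ℂ[NDF_n]`-module `P_n^k = ⋀ᵏ ℂⁿ`; as a complex vector space it is `⋀ᵏ ℂⁿ` by
definition, and the `ℂ[NDF_n]`-module structure below extends the diagonal action linearly. -/
def P (n k : ℕ) : Type := ⋀[ℂ]^k (Fin n → ℂ)

noncomputable instance (n k : ℕ) : AddCommGroup (P n k) :=
  inferInstanceAs (AddCommGroup (⋀[ℂ]^k (Fin n → ℂ)))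

noncomputable instance (n k : ℕ) : Module ℂ (P n k) :=
  inferInstanceAs (Module ℂ (⋀[ℂ]^k (Fin n → ℂ)))

/-- The identity, regarded as an isomorphism from `P_n^k` to `⋀ᵏ ℂⁿ`. -/
noncomputable def P.toExterior (n k : ℕ) : P n k ≃ₗ[ℂ] ⋀[ℂ]^k (Fin n → ℂ) where
  toFun x := x
  invFun x := x
  map_add' _ _ := rfl
  map_smul' _ _ := rfl
  left_inv _ := rfl
  right_inv _ := rfl

/-- The diagonal action of `NDF_n` on `P_n^k`. -/
noncomputable def rep (n k : ℕ) : Representation ℂ (NDF n) (P n k) where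
  toFun f := (P.toExterior n k).symm.conj (exterior n k f)
  map_one' := by rw [map_one]; exact LinearEquiv.conj_id _
  map_mul' f g := by rw [map_mul]; exact LinearEquiv.conj_comp _ _ _

noncomputable instance (n k : ℕ) : Module (NDFAlgebra n) (P n k) :=
  Module.compHom (P n k) (rep n k).asAlgebraHom.toRingHom

theorem P.smul_def (n k : ℕ) (a : NDFAlgebra n) (x : P n k) :
    a • x = (rep n k).asAlgebraHom a x := rfl

/-- A function `f` acts on `P_n^k = ⋀ᵏ ℂⁿ` by the `k`-th exterior power of its natural action. -/
theorem P.single_smul (n k : ℕ) (f : NDF n) (x : P n k) :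
    P.toExterior n k (MonoidAlgebra.single f (1 : ℂ) • x) =
      exteriorPower.map k (natural n f) (P.toExterior n k x) := by
  rw [P.smul_def, Representation.asAlgebraHom_single_one]; rfl

instance (n k : ℕ) : IsScalarTower ℂ (NDFAlgebra n) (P n k) where
  smul_assoc c a x := by
    rw [P.smul_def, P.smul_def, map_smul, LinearMap.smul_apply]

/-- The linear form on `ℂⁿ` sending every basis vector `e_i` to `1`. -/
noncomputable def coordSum (n : ℕ) : (Fin n → ℂ) →ₗ[ℂ] ℂ := ∑ i, LinearMap.proj i

theorem coordSum_single (n : ℕ) (i : Fin n) : coordSum n (Pi.single i 1) = 1 := by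
  simp [coordSum, LinearMap.sum_apply]

theorem coordSum_natural (n : ℕ) (f : NDF n) (x : Fin n → ℂ) :
    coordSum n (natural n f x) = coordSum n x := by
  have h : coordSum n ∘ₗ natural n f = coordSum n := (Pi.basisFun ℂ (Fin n)).ext fun i => by
    rw [Pi.basisFun_apply, LinearMap.comp_apply, coordSum_single]
    exact (congrArg _ (naturalMap_single n f i)).trans (coordSum_single n _)
  exact LinearMap.congr_fun h x

/-- The border map `⋀ᵏ⁺¹ ℂⁿ → ⋀ᵏ ℂⁿ` as a linear map, characterised on decomposable elements by
`boundaryLinear_ιMulti` and on the standard basis by `boundaryLinear_basis`. -/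
noncomputable def boundaryLinear (n k : ℕ) :
    ⋀[ℂ]^(k + 1) (Fin n → ℂ) →ₗ[ℂ] ⋀[ℂ]^k (Fin n → ℂ) :=
  exteriorPower.alternatingMapLinearEquiv
    ((-1 : ℂ) ^ k • AlternatingMap.alternatizeUncurryFin
      ((coordSum n).smulRight (exteriorPower.ιMulti ℂ k (M := Fin n → ℂ))))

theorem boundaryLinear_ιMulti (n k : ℕ) (v : Fin (k + 1) → (Fin n → ℂ)) :
    boundaryLinear n k (exteriorPower.ιMulti ℂ (k + 1) v) =
      ∑ i : Fin (k + 1), ((-1 : ℂ) ^ (k - (i : ℕ)) * coordSum n (v i)) •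
        exteriorPower.ιMulti ℂ k (fun j => v (i.succAbove j)) := by
  rw [boundaryLinear, exteriorPower.alternatingMapLinearEquiv_apply_ιMulti,
    AlternatingMap.smul_apply, AlternatingMap.alternatizeUncurryFin_apply, Finset.smul_sum]
  refine Finset.sum_congr rfl fun i _ => ?_
  have hs : (-1 : ℂ) ^ k * (-1) ^ (i : ℕ) = (-1) ^ (k - (i : ℕ)) := by
    obtain ⟨m, hm⟩ := Nat.exists_eq_add_of_le (Nat.lt_succ_iff.mp i.2)
    rw [show (-1 : ℂ) ^ k = (-1) ^ (i : ℕ) * (-1) ^ m by rw [← pow_add, ← hm],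
      show k - (i : ℕ) = m by omega, mul_right_comm, ← mul_pow]
    simp
  rw [← hs, mul_smul, mul_smul, ← Int.cast_smul_eq_zsmul ℂ]
  simp only [LinearMap.smulRight_apply, AlternatingMap.smul_apply]
  push_cast
  rfl

/-- For `s₀ < ⋯ < sₖ`, the border map sends `e_{s₀} ∧ ⋯ ∧ e_{sₖ}` to the sum over `i` of
`(-1)^(k - i)` times the same product with the factor `e_{sᵢ}` removed. -/
theorem boundaryLinear_basis (n k : ℕ) (s : Fin (k + 1) ↪o Fin n) :
    boundaryLinear n k (exteriorPower.ιMulti ℂ (k + 1) fun j => Pi.single (s j) 1) =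
      ∑ i : Fin (k + 1), (-1 : ℂ) ^ (k - (i : ℕ)) •
        exteriorPower.ιMulti ℂ k (fun j => Pi.single (s (i.succAbove j)) 1) := by
  rw [boundaryLinear_ιMulti]
  simp only [coordSum_single, mul_one]

theorem boundaryLinear_map_ιMulti (n k : ℕ) (f : NDF n) (v : Fin (k + 1) → (Fin n → ℂ)) :
    boundaryLinear n k (exteriorPower.map (k + 1) (natural n f)
        (exteriorPower.ιMulti ℂ (k + 1) v)) =
      exteriorPower.map k (natural n f)
        (boundaryLinear n k (exteriorPower.ιMulti ℂ (k + 1) v)) := by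
  rw [exteriorPower.map_apply_ιMulti, boundaryLinear_ιMulti, boundaryLinear_ιMulti, map_sum]
  refine Finset.sum_congr rfl fun i _ => ?_
  rw [map_smul, exteriorPower.map_apply_ιMulti, Function.comp_apply, coordSum_natural]
  rfl

theorem boundaryLinear_comm (n k : ℕ) (f : NDF n) (x : ⋀[ℂ]^(k + 1) (Fin n → ℂ)) :
    boundaryLinear n k (exteriorPower.map (k + 1) (natural n f) x) =
      exteriorPower.map k (natural n f) (boundaryLinear n k x) := by
  have h : boundaryLinear n k ∘ₗ exteriorPower.map (k + 1) (natural n f) =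
      exteriorPower.map k (natural n f) ∘ₗ boundaryLinear n k :=
    exteriorPower.linearMap_ext (AlternatingMap.ext (boundaryLinear_map_ιMulti n k f))
  exact LinearMap.congr_fun h x

/-- The border map `δ : P_n^k → P_n^{k-1}` as a morphism of `ℂ[NDF_n]`-modules, for `k ≥ 1`
(and zero for `k = 0`). -/
noncomputable def δ (n : ℕ) : (k : ℕ) → P n k →ₗ[NDFAlgebra n] P n (k - 1)
  | 0 => 0
  | k + 1 => MonoidAlgebra.equivariantOfLinearOfComm (V := P n (k + 1)) (W := P n k)
      ((P.toExterior n k).symm.toLinearMap ∘ₗ boundaryLinear n k ∘ₗ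
        (P.toExterior n (k + 1)).toLinearMap)
      fun f x => (P.toExterior n k).injective <| by
        rw [P.single_smul]
        simp only [LinearMap.comp_apply, LinearEquiv.coe_coe, LinearEquiv.apply_symm_apply]
        rw [P.single_smul]
        exact boundaryLinear_comm n k f _

theorem δ_succ (n k : ℕ) (x : P n (k + 1)) :
    P.toExterior n k (δ n (k + 1) x) = boundaryLinear n k (P.toExterior n (k + 1) x) := rfl

/-- The `ℂ[NDF_n]`-module `S_n^k = P_n^k / ker δ`. -/
abbrev S (n k : ℕ) : Type := P n k ⧸ LinearMap.ker (δ n k)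

end NDF

/-- A module is indecomposable if it is nonzero and is not the internal direct sum of two nonzero
submodules. -/
def IsIndecomposableModule (A : Type*) [Ring A] (M : Type*) [AddCommGroup M] [Module A M] : Prop :=
  Nontrivial M ∧ ∀ N N' : Submodule A M, IsCompl N N' → N = ⊥ ∨ N' = ⊥

/-! Indices start at 0. Everything rests on normalized elements of level `m`: those fixed by `i ↦
min i m` and killed by each collapse `j + 1 ↦ j`, `j < m`. The vector `top = e_0 ∧ ⋯ ∧ e_m` is one
of them and generates `P n (m + 1)`. The algebra element `idem n m` satisfies the same relations
under left multiplication, so `a • top ↦ a * idem n m` is well defined and splits `a ↦ a • top`.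
Hence `P n (m + 1)` is projective, and morphisms from it to `M` correspond to the normalized
elements of level `m` in `M`.

Two facts then decide the theorem. Every nonzero module has a nonzero normalized element
(`exists_isNormalized`). In `P n l` those of level `m` form a space of dimension at most one, which
is zero unless `l` is `m + 1` or `m` (`IsNormalized.level`, `IsNormalized.exists_eq_smul`). This
bounds the Hom spaces; the identity and `δ` attain the bound.

Comparing levels in `P n (m + 1)` and in its image under `δ` shows that every proper submodule lies
in `ker δ` (`eq_top_of_not_le_ker`). So `P n (m + 1)` is indecomposable with simple head `S n (m +
1)`, and both classifications follow by lifting along projectives. -/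

/-- A nonzero module over a semiprimary ring has a maximal submodule. -/
theorem IsSemiprimaryRing.exists_isCoatom (R : Type*) [Ring R] [IsSemiprimaryRing R]
    (M : Type u) [AddCommGroup M] [Module R M] [Nontrivial M] :
    ∃ N : Submodule R M, IsCoatom N := by
  -- `M` need not be finitely generated, so the argument goes by dévissage: semisimple modules are
  -- coatomic, and in an extension a maximal submodule comes from the quotient, or from `N` when the
  -- quotient vanishes.
  refine IsSemiprimaryRing.induction R R M
    (P := fun M _ _ _ => Nontrivial M → ∃ N : Submodule R M, IsCoatom N) ?_ ?_ inferInstance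
  · intro M _ _ _ _ _ _ _
    exact IsCoatomic.exists_coatom _
  · intro M _ _ _ _ N hN hQ _
    by_cases h : N = ⊤
    · have e : N ≃ₗ[R] M := LinearEquiv.ofTop N h
      obtain ⟨K, hK⟩ := hN e.toEquiv.nontrivial
      exact ⟨_, (OrderIso.isCoatom_iff (Submodule.orderIsoMapComap e) K).2 hK⟩
    · obtain ⟨K, hK⟩ := hQ (Submodule.Quotient.nontrivial_iff.2 h)
      refine ⟨K.comap N.mkQ, isSimpleModule_iff_isCoatom.1 ?_⟩
      have := isSimpleModule_iff_isCoatom.2 hK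
      have hs : Function.Surjective (K.mkQ ∘ₗ N.mkQ) :=
        K.mkQ_surjective.comp N.mkQ_surjective
      have hk : LinearMap.ker (K.mkQ ∘ₗ N.mkQ) = K.comap N.mkQ := by
        rw [LinearMap.ker_comp, Submodule.ker_mkQ]
      have := IsSimpleModule.congr ((K.mkQ ∘ₗ N.mkQ).quotKerEquivOfSurjective hs)
      rwa [hk] at this

/-! ### Collapsing maps and the elements `idem n m` -/

namespace NDF

/-- The monotone map `i ↦ min i m`. -/
def trunc (n m : ℕ) : NDF n where
  toFun i := ⟨min (i : ℕ) m, lt_of_le_of_lt (min_le_left _ _) i.2⟩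
  monotone' a b h := min_le_min_right m (show (a : ℕ) ≤ b from h)

/-- The monotone map sending `j + 1` to `j` and fixing every other element. -/
def lower (n j : ℕ) : NDF n where
  toFun i := ⟨if (i : ℕ) = j + 1 then j else i, by have := i.2; split_ifs <;> omega⟩
  monotone' a b h := by
    have : (a : ℕ) ≤ b := h
    show (if (a : ℕ) = j + 1 then j else a) ≤ if (b : ℕ) = j + 1 then j else b
    split_ifs <;> omega

theorem coe_trunc (n m : ℕ) (i : Fin n) : (trunc n m i : ℕ) = min (i : ℕ) m := rfl

theorem coe_lower (n j : ℕ) (i : Fin n) :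
    (lower n j i : ℕ) = if (i : ℕ) = j + 1 then j else i := rfl

theorem mul_apply (n : ℕ) (f g : NDF n) (i : Fin n) : (f * g) i = f (g i) := rfl

theorem trunc_mul_trunc (n m : ℕ) : trunc n m * trunc n m = trunc n m := by
  ext i; simp [coe_trunc]

/-- On the chain `{0, …, m}`, collapsing two neighbours factors through `{0, …, m - 1}`. -/
theorem lower_mul_trunc (n : ℕ) {j m : ℕ} (h : j ≤ m) :
    ∃ f g : NDF n, lower n j * trunc n (m + 1) = f * trunc n m * g := by
  -- The right factor closes the gap at `j + 1`, the left factor reopens it. The cap `n - 1` only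
  -- keeps the left factor inside the chain; it is never active on the composite.
  refine ⟨⟨fun i => ⟨if (i : ℕ) ≤ j then i else min (i + 1) (n - 1),
      by have := i.2; split_ifs <;> omega⟩, fun a b hab => ?_⟩,
    ⟨fun i => ⟨if (i : ℕ) ≤ j then i else i - 1,
      by have := i.2; split_ifs <;> omega⟩, fun a b hab => ?_⟩, ?_⟩
  · have : (a : ℕ) ≤ b := hab
    have := b.2
    show (if (a : ℕ) ≤ j then (a : ℕ) else min (a + 1) (n - 1)) ≤
      if (b : ℕ) ≤ j then (b : ℕ) else min (b + 1) (n - 1)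
    split_ifs <;> omega
  · have : (a : ℕ) ≤ b := hab
    show (if (a : ℕ) ≤ j then (a : ℕ) else a - 1) ≤ if (b : ℕ) ≤ j then (b : ℕ) else b - 1
    split_ifs <;> omega
  · ext i
    have := i.2
    show (if min (i : ℕ) (m + 1) = j + 1 then j else min (i : ℕ) (m + 1)) =
      if min (if (i : ℕ) ≤ j then (i : ℕ) else i - 1) m ≤ j
        then min (if (i : ℕ) ≤ j then (i : ℕ) else i - 1) m
        else min (min (if (i : ℕ) ≤ j then (i : ℕ) else i - 1) m + 1) (n - 1)
    split_ifs <;> omega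

/-- A function, as an element of the monoid algebra. -/
noncomputable def toAlg (n : ℕ) : NDF n →* NDFAlgebra n := MonoidAlgebra.of ℂ (NDF n)

/-- The element `(1 - t_{m-1}) ⋯ (1 - t_0)` of the algebra, where `t_j` sends `j + 1` to `j`. -/
noncomputable def altProd (n : ℕ) : ℕ → NDFAlgebra n
  | 0 => 1
  | m + 1 => (1 - toAlg n (lower n m)) * altProd n m

/-- The idempotent of the algebra generating `P_n^{m+1}`. -/
noncomputable def idem (n m : ℕ) : NDFAlgebra n := altProd n m * toAlg n (trunc n m)

/-- The factor `1 - t_j` is killed because `f * t_j = f`. The factors to its left are harmless: for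
`i > j`, `t_i` fixes `j` and `j + 1`, so `f * t_i` identifies them too. -/
theorem toAlg_mul_altProd_eq_zero (n : ℕ) {m j : ℕ} (hj : j < m) (hn : j + 1 < n) (f : NDF n)
    (hf : f ⟨j, by omega⟩ = f ⟨j + 1, hn⟩) : toAlg n f * altProd n m = 0 := by
  induction m generalizing f with
  | zero => omega
  | succ m ih =>
    rw [altProd, ← mul_assoc, mul_sub, mul_one, ← map_mul]
    obtain rfl | hjm := Nat.eq_or_lt_of_le (Nat.le_of_lt_succ hj)
    · have : f * lower n j = f := by
        refine OrderHom.ext _ _ (funext fun i => ?_)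
        rw [mul_apply]
        by_cases hi : (i : ℕ) = j + 1
        · rw [show lower n j i = ⟨j, by omega⟩ from Fin.ext (by simp [coe_lower, hi]), hf]
          exact congrArg f (Fin.ext hi.symm)
        · exact congrArg f (Fin.ext (by simp [coe_lower, hi]))
      rw [this, sub_self, zero_mul]
    · rw [sub_mul, ih hjm f hf, ih hjm, sub_zero]
      rw [mul_apply, mul_apply]
      convert hf using 2
      · exact Fin.ext (by simp only [coe_lower]; split_ifs <;> omega)
      · exact Fin.ext (by simp only [coe_lower]; split_ifs <;> omega)

/-- Truncation lands in `{0, …, K}` and every collapse preserves this set. The bound `K` is separate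
from the number `m` of factors so that it stays fixed during the induction. -/
theorem toAlg_mul_altProd_congr (n : ℕ) {m K : ℕ} (hm : m ≤ K) (f g : NDF n)
    (hfg : ∀ i : Fin n, (i : ℕ) ≤ K → f i = g i) :
    toAlg n f * (altProd n m * toAlg n (trunc n K)) =
      toAlg n g * (altProd n m * toAlg n (trunc n K)) := by
  induction m generalizing f g with
  | zero =>
    rw [altProd, one_mul, ← map_mul, ← map_mul]
    congr 1
    refine OrderHom.ext _ _ (funext fun i => hfg _ ?_)
    simp [coe_trunc]
  | succ m ih =>
    rw [altProd]
    simp only [sub_mul, one_mul, mul_sub]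
    congr 1
    · exact ih (by omega) f g hfg
    · simp only [mul_assoc]
      rw [← mul_assoc (toAlg n f), ← mul_assoc (toAlg n g), ← map_mul, ← map_mul]
      refine ih (by omega) _ _ fun i hi => ?_
      rw [mul_apply, mul_apply]
      refine hfg _ ?_
      rw [coe_lower]; split_ifs <;> omega

theorem toAlg_mul_idem_congr (n m : ℕ) (f g : NDF n)
    (hfg : ∀ i : Fin n, (i : ℕ) ≤ m → f i = g i) :
    toAlg n f * idem n m = toAlg n g * idem n m :=
  toAlg_mul_altProd_congr n le_rfl f g hfg

theorem toAlg_mul_idem_eq_zero (n : ℕ) {m j : ℕ} (hj : j < m) (hn : j + 1 < n) (f : NDF n)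
    (hf : f ⟨j, by omega⟩ = f ⟨j + 1, hn⟩) : toAlg n f * idem n m = 0 := by
  rw [idem, ← mul_assoc, toAlg_mul_altProd_eq_zero n hj hn f hf, zero_mul]

/-! ### Normalized elements of a module -/

section Normalized

variable {n : ℕ} {M : Type*} [AddCommGroup M] [Module (NDFAlgebra n) M]

/-- An element of a module is normalized of level `m` if it is fixed by `i ↦ min i m` and killed
by the collapsing maps `j + 1 ↦ j` for `j < m`. -/
def IsNormalized (m : ℕ) (x : M) : Prop :=
  toAlg n (trunc n m) • x = x ∧ ∀ j < m, toAlg n (lower n j) • x = 0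

theorem IsNormalized.idem_smul {m : ℕ} {x : M} (hx : IsNormalized (n := n) m x) :
    idem n m • x = x := by
  have key : ∀ l ≤ m, altProd n l • x = x := by
    intro l hl
    induction l with
    | zero => rw [altProd, one_smul]
    | succ l ih => rw [altProd, mul_smul, ih (by omega), sub_smul, one_smul, hx.2 l (by omega),
        sub_zero]
  rw [idem, mul_smul, hx.1, key m le_rfl]

theorem IsNormalized.map {M' : Type*} [AddCommGroup M'] [Module (NDFAlgebra n) M']
    (φ : M →ₗ[NDFAlgebra n] M') {m : ℕ} {x : M} (hx : IsNormalized (n := n) m x) :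
    IsNormalized (n := n) m (φ x) := by
  refine ⟨by rw [← map_smul, hx.1], fun j hj => by rw [← map_smul, hx.2 j hj, map_zero]⟩

/-- A nonzero module contains a nonzero normalized element. -/
theorem exists_isNormalized [Nontrivial M] (hn : 0 < n) :
    ∃ m < n, ∃ x : M, x ≠ 0 ∧ IsNormalized (n := n) m x := by
  by_contra! H
  obtain ⟨x, hx⟩ := exists_ne (0 : M)
  -- If `trunc n m` is the first truncation acting nontrivially, its image is normalized: a collapse
  -- after it factors through the previous truncation, which acts as zero.
  have key : ∀ m < n, ∀ y : M, toAlg n (trunc n m) • y = 0 := by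
    intro m
    induction m with
    | zero =>
      intro hm y
      by_contra hy
      refine H 0 hm _ hy ⟨?_, fun j hj => by omega⟩
      rw [smul_smul, ← map_mul, trunc_mul_trunc]
    | succ m ih =>
      intro hm y
      by_contra hy
      refine H (m + 1) hm _ hy ⟨?_, fun j hj => ?_⟩
      · rw [smul_smul, ← map_mul, trunc_mul_trunc]
      · obtain ⟨f, g, h⟩ := lower_mul_trunc n (Nat.le_of_lt_succ hj)
        rw [smul_smul, ← map_mul, h, map_mul, map_mul, mul_smul, mul_smul, ih (by omega),
          smul_zero]
  refine hx ?_
  rw [← key (n - 1) (by omega) x]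
  have : trunc n (n - 1) = 1 := by
    ext i
    have := i.2
    show min (i : ℕ) (n - 1) = i
    omega
  rw [this, map_one, one_smul]

end Normalized

end NDF
namespace NDF

/-! ### The action on the wedge basis -/

/-- The element `e_{u 0} ∧ ⋯ ∧ e_{u (k-1)}` of `P_n^k`. -/
noncomputable def wedge (n : ℕ) {k : ℕ} (u : Fin k → Fin n) : P n k :=
  (P.toExterior n k).symm (exteriorPower.ιMulti ℂ k fun i => Pi.single (u i) 1)

theorem toExterior_wedge (n : ℕ) {k : ℕ} (u : Fin k → Fin n) :
    P.toExterior n k (wedge n u) = exteriorPower.ιMulti ℂ k fun i => Pi.single (u i) 1 :=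
  LinearEquiv.apply_symm_apply _ _

theorem toAlg_smul_wedge (n : ℕ) {k : ℕ} (f : NDF n) (u : Fin k → Fin n) :
    toAlg n f • wedge n u = wedge n (f ∘ u) := by
  apply (P.toExterior n k).injective
  rw [toAlg, MonoidAlgebra.of_apply, P.single_smul, toExterior_wedge, toExterior_wedge,
    exteriorPower.map_apply_ιMulti]
  congr 1
  funext i
  exact naturalMap_single n f (u i)

theorem wedge_eq_zero (n : ℕ) {k : ℕ} (u : Fin k → Fin n) {i j : Fin k} (hij : i ≠ j)
    (h : u i = u j) : wedge n u = 0 := by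
  rw [wedge, AlternatingMap.map_eq_zero_of_eq _ _ (by rw [h]) hij, map_zero]

/-- The basis of `P_n^k` formed by the products `e_{s 0} ∧ ⋯ ∧ e_{s (k-1)}`, `s 0 < ⋯ < s (k-1)`. -/
noncomputable def wedgeBasis (n k : ℕ) : Module.Basis (Fin k ↪o Fin n) ℂ (P n k) :=
  (((Pi.basisFun ℂ (Fin n)).exteriorPower k).reindex Set.powersetCard.ofFinEmbEquiv.symm).map
    (P.toExterior n k).symm

theorem wedgeBasis_apply (n k : ℕ) (s : Fin k ↪o Fin n) : wedgeBasis n k s = wedge n s := by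
  rw [wedgeBasis, Module.Basis.map_apply, Module.Basis.reindex_apply, exteriorPower.basis_apply,
    wedge, Equiv.symm_symm]
  congr 1
  apply Subtype.ext
  simp [ExteriorAlgebra.ιMulti_family, Function.comp_def]

/-- A non-decreasing sequence is strictly increasing or has two equal consecutive terms. -/
theorem exists_eq_succ_or_strictMono {n k : ℕ} (u : Fin k → Fin n) (hu : Monotone u) :
    (∃ (j : ℕ) (h : j + 1 < k), u ⟨j, by omega⟩ = u ⟨j + 1, h⟩) ∨ StrictMono u := by
  by_cases hs : Function.Injective u
  · exact Or.inr (hu.strictMono_of_injective hs)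
  · left
    by_contra! H
    apply hs
    cases k with
    | zero => exact fun a => a.elim0
    | succ k =>
      refine (Fin.strictMono_iff_lt_succ.2 fun i => ?_).injective
      exact lt_of_le_of_ne (hu i.castSucc_lt_succ.le) (H i (by omega))

/-- Monotonicity rules out signs: the wedge is either a basis vector or zero because of a repeated
factor. -/
theorem coeff_wedge (n : ℕ) {k : ℕ} (u : Fin k → Fin n) (hu : Monotone u)
    (s : Fin k ↪o Fin n) : (wedgeBasis n k).repr (wedge n u) s = if u = s then 1 else 0 := by
  classical
  rcases exists_eq_succ_or_strictMono u hu with ⟨j, hj, h⟩ | h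
  · have hne : (⟨j, by omega⟩ : Fin k) ≠ ⟨j + 1, hj⟩ := by simp [Fin.ext_iff]
    have hus : u ≠ s := fun e => hne (s.injective (by rw [← e]; exact h))
    rw [wedge_eq_zero n u hne h, if_neg hus, map_zero, Finsupp.zero_apply]
  · have : wedge n u = wedgeBasis n k (OrderEmbedding.ofStrictMono u h) := by
      rw [wedgeBasis_apply, OrderEmbedding.coe_ofStrictMono]
    rw [this, Module.Basis.repr_self, Finsupp.single_apply]
    refine if_congr ?_ rfl rfl
    rw [DFunLike.ext'_iff, OrderEmbedding.coe_ofStrictMono]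

theorem coeff_toAlg_smul (n : ℕ) {k : ℕ} (f : NDF n) (x : P n k) (s : Fin k ↪o Fin n) :
    (wedgeBasis n k).repr (toAlg n f • x) s =
      ∑ u : Fin k ↪o Fin n, if f ∘ u = s then (wedgeBasis n k).repr x u else 0 := by
  conv_lhs => rw [← (wedgeBasis n k).sum_repr x, Finset.smul_sum]
  rw [map_sum, Finset.sum_apply']
  refine Finset.sum_congr rfl fun u _ => ?_
  rw [smul_comm, map_smul, wedgeBasis_apply, toAlg_smul_wedge, Finsupp.smul_apply,
    coeff_wedge n _ (f.monotone.comp u.monotone)]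
  split_ifs <;> simp

/-- The product of the first `k` basis vectors. -/
noncomputable def top (n : ℕ) {k : ℕ} (h : k ≤ n) : P n k := wedge n (Fin.castLEOrderEmb h)

theorem top_ne_zero (n : ℕ) {k : ℕ} (h : k ≤ n) : top n h ≠ 0 := by
  rw [top, ← wedgeBasis_apply]; exact (wedgeBasis n k).ne_zero _

theorem isNormalized_top (n : ℕ) {m : ℕ} (h : m + 1 ≤ n) :
    IsNormalized (n := n) m (top n h) := by
  refine ⟨?_, fun j hj => ?_⟩
  · rw [top, toAlg_smul_wedge]
    congr 1
    funext i
    have := i.2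
    exact Fin.ext (by simp [coe_trunc]; omega)
  · rw [top, toAlg_smul_wedge]
    refine wedge_eq_zero n _ (i := ⟨j, by omega⟩) (j := ⟨j + 1, by omega⟩) (by simp) ?_
    exact Fin.ext (by simp [coe_lower])

/-- The extension of an embedding of an initial segment, constant beyond that segment. -/
def extend {n m : ℕ} (s : Fin (m + 1) ↪o Fin n) : NDF n where
  toFun i := s ⟨min (i : ℕ) m, by omega⟩
  monotone' a b h := s.monotone (Fin.mk_le_mk.2 (min_le_min_right m (show (a : ℕ) ≤ b from h)))

theorem extend_comp {n m : ℕ} (h : m + 1 ≤ n) (s : Fin (m + 1) ↪o Fin n) :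
    extend s ∘ Fin.castLEOrderEmb h = s := by
  funext i
  exact congrArg s (Fin.ext (by have := i.2; show min (i : ℕ) m = i; omega))

theorem extend_smul_top {n m : ℕ} (h : m + 1 ≤ n) (s : Fin (m + 1) ↪o Fin n) :
    toAlg n (extend s) • top n h = wedgeBasis n (m + 1) s := by
  rw [top, toAlg_smul_wedge, extend_comp, wedgeBasis_apply]

/-- `P_n^{m+1}` is generated by the product of the first basis vectors. -/
theorem exists_smul_top {n m : ℕ} (h : m + 1 ≤ n) (x : P n (m + 1)) :
    ∃ a : NDFAlgebra n, a • top n h = x := by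
  refine ⟨∑ s, (wedgeBasis n (m + 1)).repr x s • toAlg n (extend s), ?_⟩
  rw [Finset.sum_smul]
  conv_rhs => rw [← (wedgeBasis n (m + 1)).sum_repr x]
  exact Finset.sum_congr rfl fun s _ => by rw [smul_assoc, extend_smul_top]

/-! ### Projectivity and morphisms out of `P n (m + 1)` -/

/-- The linear map `P_n^{m+1} → ℂ[NDF_n]` sending `a • top` to `a * idem`. -/
noncomputable def sectionLinear (n m : ℕ) : P n (m + 1) →ₗ[ℂ] NDFAlgebra n :=
  (wedgeBasis n (m + 1)).constr ℂ fun s => toAlg n (extend s) * idem n m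

/-- By linearity `a` may be a function `f`. If `f` identifies two neighbours in `{0, …, m}`, both
sides vanish; otherwise `f • top` is a basis vector, and `f` agrees on `{0, …, m}` with the
extension used to define the map. -/
theorem sectionLinear_smul_top {n m : ℕ} (h : m + 1 ≤ n) (a : NDFAlgebra n) :
    sectionLinear n m (a • top n h) = a * idem n m := by
  induction a using MonoidAlgebra.induction_linear with
  | zero => rw [zero_smul, map_zero, zero_mul]
  | add a b ha hb => rw [add_smul, map_add, ha, hb, add_mul]
  | single f c =>
    have : (MonoidAlgebra.single f c : NDFAlgebra n) = c • toAlg n f := by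
      rw [toAlg, MonoidAlgebra.of_apply, MonoidAlgebra.smul_single, smul_eq_mul, mul_one]
    rw [this, smul_assoc, LinearMap.map_smul, smul_mul_assoc]
    refine congrArg (c • ·) ?_
    rw [top, toAlg_smul_wedge]
    rcases exists_eq_succ_or_strictMono (f ∘ Fin.castLEOrderEmb h)
      (f.monotone.comp (Fin.castLEOrderEmb h).monotone) with ⟨j, hj, hf⟩ | hf
    · rw [wedge_eq_zero n _ (by simp [Fin.ext_iff]) hf, map_zero,
        toAlg_mul_idem_eq_zero n (j := j) (by omega) (by omega) f hf]
    · have : wedge n (f ∘ Fin.castLEOrderEmb h) =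
          wedgeBasis n (m + 1) (OrderEmbedding.ofStrictMono _ hf) := by
        rw [wedgeBasis_apply, OrderEmbedding.coe_ofStrictMono]
      rw [this, sectionLinear, Module.Basis.constr_basis]
      refine toAlg_mul_idem_congr n m _ _ fun i hi => ?_
      refine congrArg f (Fin.ext ?_)
      show min (i : ℕ) m = i
      omega

/-- The module morphism `P_n^{m+1} → ℂ[NDF_n]` sending `a • top` to `a * idem`. -/
noncomputable def sectionMap {n m : ℕ} (h : m + 1 ≤ n) :
    P n (m + 1) →ₗ[NDFAlgebra n] NDFAlgebra n where
  toFun := sectionLinear n m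
  map_add' := map_add _
  map_smul' a x := by
    obtain ⟨b, rfl⟩ := exists_smul_top h x
    rw [smul_smul, sectionLinear_smul_top, sectionLinear_smul_top, mul_assoc]; rfl

theorem sectionMap_top {n m : ℕ} (h : m + 1 ≤ n) : sectionMap h (top n h) = idem n m := by
  have := sectionLinear_smul_top h 1
  rwa [one_smul, one_mul] at this

theorem projective_P {n m : ℕ} (h : m + 1 ≤ n) :
    Module.Projective (NDFAlgebra n) (P n (m + 1)) := by
  refine Module.Projective.of_split (sectionMap h)
    (LinearMap.toSpanSingleton (NDFAlgebra n) _ (top n h)) (LinearMap.ext fun x => ?_)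
  obtain ⟨a, rfl⟩ := exists_smul_top h x
  rw [LinearMap.comp_apply, map_smul, sectionMap_top, LinearMap.toSpanSingleton_apply,
    smul_eq_mul, mul_smul, (isNormalized_top n h).idem_smul]; rfl

section Normalized

variable {n : ℕ} {M : Type*} [AddCommGroup M] [Module (NDFAlgebra n) M]

theorem isNormalized_idem {m : ℕ} (h : m + 1 ≤ n) : IsNormalized (n := n) m (idem n m) := by
  rw [← sectionMap_top h]; exact (isNormalized_top n h).map _

theorem isNormalized_idem_smul {m : ℕ} (h : m + 1 ≤ n) (x : M) :
    IsNormalized (n := n) m (idem n m • x) :=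
  (isNormalized_idem h).map (LinearMap.toSpanSingleton (NDFAlgebra n) M x)

/-- A normalized element defines a morphism from `P_n^{m+1}`. -/
theorem IsNormalized.exists_map {m : ℕ} (h : m + 1 ≤ n) {x : M}
    (hx : IsNormalized (n := n) m x) :
    ∃ φ : P n (m + 1) →ₗ[NDFAlgebra n] M, φ (top n h) = x :=
  ⟨LinearMap.toSpanSingleton (NDFAlgebra n) M x ∘ₗ sectionMap h, by
    rw [LinearMap.comp_apply, sectionMap_top, LinearMap.toSpanSingleton_apply, hx.idem_smul]⟩

theorem hom_ext_top {m : ℕ} (h : m + 1 ≤ n) {φ ψ : P n (m + 1) →ₗ[NDFAlgebra n] M}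
    (e : φ (top n h) = ψ (top n h)) : φ = ψ := by
  ext x
  obtain ⟨a, rfl⟩ := exists_smul_top h x
  rw [map_smul, map_smul, e]

end Normalized

/-! ### Normalized elements of the exterior powers -/

/-- A strictly increasing sequence other than `0, 1, 2, …` can be lowered in one place. -/
theorem exists_lower {n l : ℕ} (s : Fin l ↪o Fin n) (hs : ∃ i, (s i : ℕ) ≠ i) :
    ∃ (i : Fin l) (j : ℕ), (s i : ℕ) = j + 1 ∧ ∀ i', (s i' : ℕ) ≠ j := by
  -- At the first index `a` with `s a ≠ a` one has `s a > a`, and the value `s a - 1` is skipped.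
  have hex : ∃ a, ∃ h : a < l, (s ⟨a, h⟩ : ℕ) ≠ a := by
    obtain ⟨i, hi⟩ := hs; exact ⟨i, i.2, hi⟩
  classical
  obtain ⟨ha, hne⟩ := Nat.find_spec hex
  have hmin := fun b (hb : b < Nat.find hex) => Nat.find_min hex hb
  generalize Nat.find hex = a at ha hne hmin
  have hmin' : ∀ b (hb : b < a), (s ⟨b, by omega⟩ : ℕ) = b := fun b hb => by
    have := hmin b hb
    push Not at this
    exact this (by omega)
  have hlt : a < (s ⟨a, ha⟩ : ℕ) := by
    refine lt_of_le_of_ne ?_ (Ne.symm hne)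
    by_contra! hlt
    have h1 := hmin' _ hlt
    have h2 : s ⟨(s ⟨a, ha⟩ : ℕ), by omega⟩ = s ⟨a, ha⟩ := Fin.ext h1
    have := congrArg Fin.val (s.injective h2)
    simp at this
    omega
  refine ⟨⟨a, ha⟩, (s ⟨a, ha⟩ : ℕ) - 1, by omega, fun i' hi' => ?_⟩
  have hi : i' < ⟨a, ha⟩ := by
    rw [← s.lt_iff_lt, Fin.lt_def]; omega
  have := hmin' i' hi
  have : (i' : ℕ) < a := hi
  simp only [Fin.eta] at *
  omega

theorem IsNormalized.coeff_eq_zero_of_lt {n l m : ℕ} {x : P n l} (hx : IsNormalized (n := n) m x)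
    (s : Fin l ↪o Fin n) {i : Fin l} (hi : m < (s i : ℕ)) : (wedgeBasis n l).repr x s = 0 := by
  rw [← hx.1, coeff_toAlg_smul]
  refine Finset.sum_eq_zero fun u _ => if_neg fun hu => ?_
  have := congrArg Fin.val (congrFun hu i)
  rw [Function.comp_apply, coe_trunc] at this
  omega

/-- The only basis vectors that the collapse sends to `s'` are those of `s` and `s'`, so the
vanishing coefficient of `t_j • x` at `s'` is the sum of these two coefficients of `x`. -/
theorem IsNormalized.coeff_eq_neg {n l m : ℕ} {x : P n l} (hx : IsNormalized (n := n) m x)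
    (s : Fin l ↪o Fin n) {j : ℕ} (hj : j < m) {i : Fin l} (hi : (s i : ℕ) = j + 1)
    (hs : ∀ i', (s i' : ℕ) ≠ j) : ∃ s' : Fin l ↪o Fin n, (s' : Fin l → Fin n) = lower n j ∘ s ∧
      (wedgeBasis n l).repr x s = - (wedgeBasis n l).repr x s' := by
  classical
  have hmono : StrictMono (lower n j ∘ s) := fun a b hab => by
    have h1 : (s a : ℕ) < s b := s.strictMono hab
    have h2 := hs a
    show (if (s a : ℕ) = j + 1 then j else (s a : ℕ)) < if (s b : ℕ) = j + 1 then j else (s b : ℕ)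
    split_ifs <;> omega
  refine ⟨OrderEmbedding.ofStrictMono _ hmono, rfl, ?_⟩
  set s' := OrderEmbedding.ofStrictMono _ hmono with hs'
  have hval : ∀ a, (s' a : ℕ) = if (s a : ℕ) = j + 1 then j else (s a : ℕ) := fun a => rfl
  have hne : s ≠ s' := fun h => by
    have h1 := hval i
    rw [← h, if_pos hi] at h1
    omega
  have h0 := coeff_toAlg_smul n (lower n j) x s'
  rw [hx.2 j hj, map_zero, Finsupp.zero_apply, ← Finset.sum_filter] at h0
  have hfil : Finset.univ.filter (fun u : Fin l ↪o Fin n => lower n j ∘ u = s') = {s, s'} := by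
    ext u
    simp only [Finset.mem_filter, Finset.mem_univ, true_and, Finset.mem_insert,
      Finset.mem_singleton]
    constructor
    · intro hu
      have hu' : ∀ a, (if (u a : ℕ) = j + 1 then j else (u a : ℕ)) =
          if (s a : ℕ) = j + 1 then j else (s a : ℕ) :=
        fun a => congrArg Fin.val (congrFun hu a)
      have hoff : ∀ a, a ≠ i → (u a : ℕ) = s a := fun a ha => by
        have h1 := hu' a
        have h2 := hs a
        have h3 : (s a : ℕ) ≠ j + 1 := fun h => ha (s.injective (Fin.ext (h.trans hi.symm)))
        split_ifs at h1 <;> omega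
      have hi' := hu' i
      rw [if_pos hi] at hi'
      by_cases hui : (u i : ℕ) = j + 1
      · left
        refine RelEmbedding.ext fun a => Fin.ext ?_
        by_cases ha : a = i
        · rw [ha, hui, hi]
        · exact hoff a ha
      · right
        rw [if_neg hui] at hi'
        refine RelEmbedding.ext fun a => Fin.ext ?_
        rw [hval]
        by_cases ha : a = i
        · rw [ha, hi', if_pos hi]
        · rw [hoff a ha, if_neg]
          exact fun h => ha (s.injective (Fin.ext (h.trans hi.symm)))
    · rintro (rfl | rfl)
      · rfl
      · funext a
        apply Fin.ext
        have := hs a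
        rw [Function.comp_apply, coe_lower, hval]
        split_ifs <;> omega
  rw [hfil, Finset.sum_pair hne] at h0
  exact eq_neg_of_add_eq_zero_left h0.symm

/-- Every coefficient reduces to that of the initial segment, by induction on the sum of the
entries: an entry `j + 1` with `j` free is lowered at the cost of a sign if `j < m`, and exceeds `m`
otherwise, making the coefficient zero. -/
theorem IsNormalized.eq_zero_of_coeff {n l m : ℕ} {x : P n l} (hx : IsNormalized (n := n) m x)
    (h : ∀ s : Fin l ↪o Fin n, (∀ i, (s i : ℕ) = i) → (wedgeBasis n l).repr x s = 0) : x = 0 := by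
  have key : ∀ (N : ℕ) (s : Fin l ↪o Fin n), ∑ i, (s i : ℕ) = N →
      (wedgeBasis n l).repr x s = 0 := by
    intro N
    induction N using Nat.strong_induction_on with
    | _ N ih =>
      intro s hN
      by_cases hs : ∀ i, (s i : ℕ) = i
      · exact h s hs
      · push Not at hs
        obtain ⟨i, j, hij, hj⟩ := exists_lower s hs
        by_cases hjm : j < m
        · obtain ⟨s', hs', hc⟩ := hx.coeff_eq_neg s hjm hij hj
          have hval : ∀ a, (s' a : ℕ) = if (s a : ℕ) = j + 1 then j else (s a : ℕ) :=
            fun a => congrArg Fin.val (congrFun hs' a)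
          rw [hc, ih (∑ i, (s' i : ℕ)) ?_ s' rfl, neg_zero]
          rw [← hN]
          refine Finset.sum_lt_sum (fun a _ => ?_) ⟨i, Finset.mem_univ _, ?_⟩
          · rw [hval]; split_ifs <;> omega
          · rw [hval, if_pos hij, hij]; omega
        · exact hx.coeff_eq_zero_of_lt s (i := i) (by omega)
  refine (wedgeBasis n l).ext_elem fun s => ?_
  rw [key _ s rfl, map_zero, Finsupp.zero_apply]

/-- Nonzero normalized elements of level `m` exist only in `P_n^{m+1}` and `P_n^m`. -/
theorem IsNormalized.level {n l m : ℕ} {x : P n l} (hx : IsNormalized (n := n) m x)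
    (h0 : x ≠ 0) : l = m + 1 ∨ l = m := by
  by_contra! H
  refine h0 (hx.eq_zero_of_coeff fun s hs => ?_)
  rcases lt_or_ge m l with hl | hl
  · exact hx.coeff_eq_zero_of_lt s (i := ⟨m + 1, by omega⟩) (by rw [hs]; simp)
  -- Here `l < m`, so the collapse `m ↦ m - 1` fixes the initial segment and sends no other basis
  -- vector to it; its coefficient is preserved and killed at once.
  · have h1 := coeff_toAlg_smul n (lower n (m - 1)) x s
    rw [hx.2 (m - 1) (by omega), map_zero, Finsupp.zero_apply, Finset.sum_eq_single s, if_pos] at h1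
    · exact h1.symm
    · funext a
      apply Fin.ext
      have := a.2
      rw [Function.comp_apply, coe_lower, hs]
      split_ifs <;> omega
    · refine fun u _ hu => if_neg fun h => hu (RelEmbedding.ext fun a => Fin.ext ?_)
      have h2 := congrArg Fin.val (congrFun h a)
      have := a.2
      rw [Function.comp_apply, coe_lower, hs] at h2
      rw [hs]
      split_ifs at h2 <;> omega
    · simp

/-- The normalized elements of level `m` of `P_n^l` are proportional. -/
theorem IsNormalized.exists_eq_smul {n l m : ℕ} {x y : P n l} (hx : IsNormalized (n := n) m x)
    (hy : IsNormalized (n := n) m y) (h0 : x ≠ 0) : ∃ c : ℂ, y = c • x := by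
  have hs : ∃ s : Fin l ↪o Fin n, (∀ i, (s i : ℕ) = i) ∧ (wedgeBasis n l).repr x s ≠ 0 := by
    by_contra! H
    exact h0 (hx.eq_zero_of_coeff H)
  obtain ⟨s, hs, hc⟩ := hs
  refine ⟨(wedgeBasis n l).repr y s / (wedgeBasis n l).repr x s, sub_eq_zero.1 ?_⟩
  refine IsNormalized.eq_zero_of_coeff (m := m) ⟨?_, fun j hj => ?_⟩ fun u hu => ?_
  · rw [smul_sub, smul_comm, hx.1, hy.1]
  · rw [smul_sub, smul_comm, hx.2 j hj, hy.2 j hj, smul_zero, sub_zero]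
  · have : u = s := RelEmbedding.ext fun a => Fin.ext (by rw [hu, hs])
    rw [this, map_sub, map_smul, Finsupp.sub_apply, Finsupp.smul_apply, smul_eq_mul,
      div_mul_cancel₀ _ hc, sub_self]

end NDF
-- Simple heads, classification and dimensions
namespace NDF

/-- Omitting different factors gives different basis vectors, so the terms cannot cancel. -/
theorem δ_top_ne_zero {n m : ℕ} (h : m + 1 ≤ n) : δ n (m + 1) (top n h) ≠ 0 := by
  intro h0
  have hsum : δ n (m + 1) (top n h) = ∑ i : Fin (m + 1), (-1 : ℂ) ^ (m - (i : ℕ)) •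
      wedgeBasis n m ((Fin.succAboveOrderEmb i).trans (Fin.castLEOrderEmb h)) := by
    apply (P.toExterior n m).injective
    rw [δ_succ, top, toExterior_wedge, boundaryLinear_basis, map_sum]
    refine Finset.sum_congr rfl fun i _ => ?_
    rw [map_smul, wedgeBasis_apply, toExterior_wedge]
    rfl
  rw [hsum] at h0
  have hinj : Function.Injective fun i : Fin (m + 1) =>
      (Fin.succAboveOrderEmb i).trans (Fin.castLEOrderEmb h) := by
    intro i j hij
    by_contra hne
    obtain ⟨a, ha⟩ := Fin.exists_succAbove_eq hne
    have h1 := DFunLike.congr_fun hij a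
    have h2 : j.succAbove a = i.succAbove a := (Fin.castLEOrderEmb h).injective h1.symm
    exact Fin.succAbove_ne i a (by rw [← h2, ha])
  have hli := (wedgeBasis n m).linearIndependent.comp _ hinj
  have := Fintype.linearIndependent_iff.1 hli (fun i => (-1 : ℂ) ^ (m - (i : ℕ))) h0 0
  exact pow_ne_zero _ (by norm_num) this

/-- A submodule of `P_n^{m+1}` which is not contained in the kernel of `δ` is everything. -/
theorem eq_top_of_not_le_ker {n m : ℕ} (h : m + 1 ≤ n) (Y : Submodule (NDFAlgebra n) (P n (m + 1)))
    (hY : ¬ Y ≤ LinearMap.ker (δ n (m + 1))) : Y = ⊤ := by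
  have hne : Y.map (δ n (m + 1)) ≠ ⊥ := fun e => hY (LinearMap.le_ker_iff_map.2 e)
  have := Submodule.nontrivial_iff_ne_bot.2 hne
  obtain ⟨l, hl, ⟨z, hz⟩, hz0, hzn⟩ :=
    exists_isNormalized (n := n) (M := Y.map (δ n (m + 1))) (by omega)
  obtain ⟨y, hy, rfl⟩ := hz
  have hzn' : IsNormalized (n := n) l (δ n (m + 1) y) := hzn.map (Submodule.subtype _)
  have hz0' : δ n (m + 1) y ≠ 0 := fun e => hz0 (Subtype.ext e)
  -- Applying `idem n l` turns a preimage in `Y` into a normalized one without changing its image.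
  -- The levels allowed in `P n (m + 1)` and in `P n m` have only `l = m` in common, so this
  -- preimage is proportional to `top`.
  have hx := isNormalized_idem_smul hl y
  have hδ : δ n (m + 1) (idem n l • y) = δ n (m + 1) y := by rw [map_smul, hzn'.idem_smul]
  have hx0 : idem n l • y ≠ 0 := fun e => hz0' (by rw [← hδ, e, map_zero])
  have h1 := hx.level hx0
  have h2 : m = l + 1 ∨ m = l := hzn'.level hz0'
  obtain rfl : l = m := by omega
  obtain ⟨c, hc⟩ := hx.exists_eq_smul (isNormalized_top n h) hx0
  have hmem : top n h ∈ Y := by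
    rw [hc, ← algebraMap_smul (NDFAlgebra n) c]
    exact Y.smul_mem _ (Y.smul_mem _ hy)
  rw [eq_top_iff]
  rintro x -
  obtain ⟨a, rfl⟩ := exists_smul_top h x
  exact Y.smul_mem _ hmem

theorem ker_δ_ne_top {n m : ℕ} (h : m + 1 ≤ n) : LinearMap.ker (δ n (m + 1)) ≠ ⊤ := fun e =>
  δ_top_ne_zero h (LinearMap.mem_ker.1 (e ▸ Submodule.mem_top))

theorem isSimpleModule_S {n m : ℕ} (h : m + 1 ≤ n) :
    IsSimpleModule (NDFAlgebra n) (S n (m + 1)) :=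
  isSimpleModule_iff_isCoatom.2 ⟨ker_δ_ne_top h, fun Y hY => eq_top_of_not_le_ker h Y hY.not_ge⟩

theorem isIndecomposable_P {n m : ℕ} (h : m + 1 ≤ n) :
    IsIndecomposableModule (NDFAlgebra n) (P n (m + 1)) := by
  refine ⟨⟨⟨_, _, top_ne_zero n h⟩⟩, fun N N' hN => ?_⟩
  by_cases h1 : N = ⊤
  · right
    have := hN.inf_eq_bot
    rwa [h1, top_inf_eq] at this
  by_cases h2 : N' = ⊤
  · left
    have := hN.inf_eq_bot
    rwa [h2, inf_top_eq] at this
  have h1' := not_imp_comm.1 (eq_top_of_not_le_ker h N) h1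
  have h2' := not_imp_comm.1 (eq_top_of_not_le_ker h N') h2
  exact absurd (top_le_iff.1 (hN.sup_eq_top ▸ sup_le h1' h2')) (ker_δ_ne_top h)

/-- A nonzero morphism `P_n^{m+1} → P_n^l` exists only if `l ∈ {m + 1, m}`. -/
theorem hom_level {n m l : ℕ} (h : m + 1 ≤ n) {φ : P n (m + 1) →ₗ[NDFAlgebra n] P n l}
    (hφ : φ ≠ 0) : l = m + 1 ∨ l = m :=
  ((isNormalized_top n h).map φ).level fun e => hφ (hom_ext_top h (by rw [e]; rfl))

/-- A morphism onto `S_n^{m+1}` from a projective module factors through a surjection onto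
`P_n^{m+1}`. -/
theorem exists_surjective_lift {n m : ℕ} (h : m + 1 ≤ n) {M : Type*} [AddCommGroup M]
    [Module (NDFAlgebra n) M] [Module.Projective (NDFAlgebra n) M]
    {φ : M →ₗ[NDFAlgebra n] S n (m + 1)} (hφ : φ ≠ 0) :
    ∃ ψ : M →ₗ[NDFAlgebra n] P n (m + 1), Function.Surjective ψ := by
  obtain ⟨ψ, hψ⟩ := Module.projective_lifting_property (LinearMap.ker (δ n (m + 1))).mkQ φ
    (Submodule.mkQ_surjective _)
  refine ⟨ψ, LinearMap.range_eq_top.1 (eq_top_of_not_le_ker h _ fun hle => hφ ?_)⟩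
  ext x
  rw [← hψ, LinearMap.comp_apply, Submodule.mkQ_apply, LinearMap.zero_apply,
    Submodule.Quotient.mk_eq_zero]
  exact hle ⟨x, rfl⟩

theorem eq_or_eq_of_surjective {n m l : ℕ} (h : m + 1 ≤ n) (hl : l + 1 ≤ n)
    {φ : P n (m + 1) →ₗ[NDFAlgebra n] P n (l + 1)} (hφ : Function.Surjective φ) :
    l = m ∨ l + 1 = m := by
  have h0 : φ ≠ 0 := by
    rintro rfl
    obtain ⟨x, hx⟩ := hφ (top n hl)
    exact top_ne_zero n hl hx.symm
  have := hom_level h h0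
  omega

/-- An isomorphism of heads lifts to a surjection between the projectives, which forces the index to
stay or drop by one; the inverse gives the opposite inequality. -/
theorem eq_of_S_equiv {n m l : ℕ} (h : m + 1 ≤ n) (hl : l + 1 ≤ n)
    (e : S n (m + 1) ≃ₗ[NDFAlgebra n] S n (l + 1)) : m = l := by
  have key : ∀ {m l : ℕ} (h : m + 1 ≤ n) (hl : l + 1 ≤ n)
      (_ : S n (m + 1) ≃ₗ[NDFAlgebra n] S n (l + 1)), l = m ∨ l + 1 = m := by
    intro m l h hl e
    have := projective_P h
    have := isSimpleModule_S hl
    have := IsSimpleModule.nontrivial (NDFAlgebra n) (S n (l + 1))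
    have hs : Function.Surjective
        (e.toLinearMap ∘ₗ (LinearMap.ker (δ n (m + 1))).mkQ) :=
      e.surjective.comp (Submodule.mkQ_surjective _)
    obtain ⟨ψ, hψ⟩ := exists_surjective_lift hl
      (φ := e.toLinearMap ∘ₗ (LinearMap.ker (δ n (m + 1))).mkQ) (by
        intro h0
        rw [h0] at hs
        obtain ⟨y, hy⟩ := exists_ne (0 : S n (l + 1))
        obtain ⟨x, hx⟩ := hs y
        exact hy hx.symm)
    exact eq_or_eq_of_surjective h hl hψ
  have := key h hl e
  have := key hl h e.symm
  omega

theorem eq_of_P_equiv {n m l : ℕ} (h : m + 1 ≤ n) (hl : l + 1 ≤ n)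
    (e : P n (m + 1) ≃ₗ[NDFAlgebra n] P n (l + 1)) : m = l := by
  have := eq_or_eq_of_surjective h hl (φ := e.toLinearMap) e.surjective
  have := eq_or_eq_of_surjective hl h (φ := e.symm.toLinearMap) e.symm.surjective
  omega

/-- A normalized element makes `M` a quotient of some `P n (m + 1)`, whose only maximal submodule is
`ker δ`. -/
theorem exists_equiv_S {n : ℕ} (hn : 0 < n) (M : Type*) [AddCommGroup M] [Module (NDFAlgebra n) M]
    [IsSimpleModule (NDFAlgebra n) M] :
    ∃ m < n, Nonempty (M ≃ₗ[NDFAlgebra n] S n (m + 1)) := by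
  have := IsSimpleModule.nontrivial (NDFAlgebra n) M
  obtain ⟨m, hm, x, hx0, hx⟩ := exists_isNormalized (n := n) (M := M) hn
  obtain ⟨φ, hφ⟩ := hx.exists_map hm
  have hφ0 : φ ≠ 0 := by
    rintro rfl
    exact hx0 hφ.symm
  have hsurj := LinearMap.surjective_of_ne_zero hφ0
  have e := φ.quotKerEquivOfSurjective hsurj
  have hco : IsCoatom (LinearMap.ker φ) :=
    isSimpleModule_iff_isCoatom.1 (IsSimpleModule.congr e)
  have hle : LinearMap.ker φ ≤ LinearMap.ker (δ n (m + 1)) :=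
    not_imp_comm.1 (eq_top_of_not_le_ker hm _) hco.1
  have heq := (hco.le_iff.1 hle).resolve_left (ker_δ_ne_top hm)
  exact ⟨m, hm, ⟨e.symm.trans (Submodule.quotEquivOfEq _ _ heq.symm)⟩⟩

instance isArtinianRing_NDFAlgebra (n : ℕ) : IsArtinianRing (NDFAlgebra n) := by
  have : Finite (NDF n) := DFunLike.finite _
  exact IsArtinianRing.of_finite ℂ (NDFAlgebra n)

/-- A simple quotient of `M` is some `S n (m + 1)`; lifting gives a surjection of `M` onto the
projective `P n (m + 1)`. It splits, and indecomposability kills its kernel. -/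
theorem exists_equiv_P {n : ℕ} (hn : 0 < n) (M : Type*) [AddCommGroup M] [Module (NDFAlgebra n) M]
    [Module.Projective (NDFAlgebra n) M] (hM : IsIndecomposableModule (NDFAlgebra n) M) :
    ∃ m < n, Nonempty (M ≃ₗ[NDFAlgebra n] P n (m + 1)) := by
  have := hM.1
  obtain ⟨N, hN⟩ := IsSemiprimaryRing.exists_isCoatom (NDFAlgebra n) M
  have := isSimpleModule_iff_isCoatom.2 hN
  obtain ⟨m, hm, ⟨e⟩⟩ := exists_equiv_S hn (M ⧸ N)
  have hφ : e.toLinearMap ∘ₗ N.mkQ ≠ 0 := by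
    intro h0
    apply hN.1
    rw [eq_top_iff]
    rintro x -
    have : e (N.mkQ x) = 0 := LinearMap.congr_fun h0 x
    rw [LinearEquiv.map_eq_zero_iff, Submodule.mkQ_apply, Submodule.Quotient.mk_eq_zero] at this
    exact this
  obtain ⟨ψ, hψ⟩ := exists_surjective_lift hm hφ
  have := projective_P hm
  obtain ⟨σ, hσ⟩ := Module.projective_lifting_property ψ LinearMap.id hψ
  have hc := LinearMap.isCompl_of_proj (f := σ.rangeRestrict ∘ₗ ψ) (p := LinearMap.range σ) (by
    rintro ⟨_, x, rfl⟩
    have : ψ (σ x) = x := LinearMap.congr_fun hσ x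
    exact Subtype.ext (by simp [this]))
  have hσi : Function.Injective σ :=
    Function.LeftInverse.injective (g := ψ) (LinearMap.congr_fun hσ)
  refine ⟨m, hm, ⟨LinearEquiv.ofBijective ψ ⟨?_, hψ⟩⟩⟩
  rcases hM.2 _ _ hc with h0 | h0
  · exfalso
    rw [LinearMap.range_eq_bot] at h0
    rw [h0] at hσi
    exact top_ne_zero n hm (hσi rfl)
  · rw [← LinearMap.ker_eq_bot, eq_bot_iff, ← h0]
    intro x hx
    rw [LinearMap.mem_ker, LinearMap.comp_apply, LinearMap.mem_ker.1 hx, map_zero]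

theorem rank_hom_eq_one {n m l : ℕ} (h : m + 1 ≤ n) (φ : P n (m + 1) →ₗ[NDFAlgebra n] P n l)
    (hφ : φ ≠ 0) : Module.rank ℂ (P n (m + 1) →ₗ[NDFAlgebra n] P n l) = 1 := by
  refine rank_eq_one φ hφ fun ψ => ?_
  have h0 : φ (top n h) ≠ 0 := fun e => hφ (hom_ext_top h (by rw [e]; rfl))
  obtain ⟨c, hc⟩ := ((isNormalized_top n h).map φ).exists_eq_smul ((isNormalized_top n h).map ψ) h0
  exact ⟨c, hom_ext_top h (by rw [hc]; rfl)⟩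

theorem rank_hom {n m l : ℕ} (h : m + 1 ≤ n) :
    Module.rank ℂ (P n (m + 1) →ₗ[NDFAlgebra n] P n l) =
      if l = m + 1 ∨ l + 1 = m + 1 then 1 else 0 := by
  split_ifs with hl
  · rcases hl with rfl | hl
    · refine rank_hom_eq_one h LinearMap.id fun e => ?_
      exact top_ne_zero n h (LinearMap.congr_fun e (top n h))
    · obtain rfl : l = m := by omega
      refine rank_hom_eq_one h (δ n (l + 1)) fun e => ?_
      exact δ_top_ne_zero h (LinearMap.congr_fun e (top n h))
  · have : Subsingleton (P n (m + 1) →ₗ[NDFAlgebra n] P n l) := by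
      refine subsingleton_of_forall_eq 0 fun φ => ?_
      by_contra hφ
      have := hom_level h hφ
      omega
    exact rank_subsingleton' ℂ _

end NDF

theorem proposition7 (n : ℕ) (hn : 1 ≤ n) :
    -- the `P_n^k`, `1 ≤ k ≤ n`, represent each indecomposable projective module exactly once
    ((∀ k ∈ Finset.Icc 1 n, Module.Projective (NDFAlgebra n) (NDF.P n k) ∧
          IsIndecomposableModule (NDFAlgebra n) (NDF.P n k)) ∧
      (∀ k ∈ Finset.Icc 1 n, ∀ l ∈ Finset.Icc 1 n,
          Nonempty (NDF.P n k ≃ₗ[NDFAlgebra n] NDF.P n l) → k = l) ∧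
      (∀ (M : Type u) [AddCommGroup M] [Module (NDFAlgebra n) M],
          Module.Projective (NDFAlgebra n) M → IsIndecomposableModule (NDFAlgebra n) M →
          ∃ k ∈ Finset.Icc 1 n, Nonempty (M ≃ₗ[NDFAlgebra n] NDF.P n k))) ∧
    -- the `S_n^k`, `1 ≤ k ≤ n`, represent each simple module exactly once
    ((∀ k ∈ Finset.Icc 1 n, IsSimpleModule (NDFAlgebra n) (NDF.S n k)) ∧
      (∀ k ∈ Finset.Icc 1 n, ∀ l ∈ Finset.Icc 1 n,
          Nonempty (NDF.S n k ≃ₗ[NDFAlgebra n] NDF.S n l) → k = l) ∧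
      (∀ (M : Type u) [AddCommGroup M] [Module (NDFAlgebra n) M],
          IsSimpleModule (NDFAlgebra n) M →
          ∃ k ∈ Finset.Icc 1 n, Nonempty (M ≃ₗ[NDFAlgebra n] NDF.S n k))) ∧
    -- dimensions of the spaces of morphisms
    (∀ k ∈ Finset.Icc 1 n, ∀ l ∈ Finset.Icc 1 n,
      Module.rank ℂ (NDF.P n k →ₗ[NDFAlgebra n] NDF.P n l) =
        if l = k ∨ l + 1 = k then 1 else 0) := by
  have index : ∀ k ∈ Finset.Icc 1 n, ∃ m, k = m + 1 ∧ m + 1 ≤ n := fun k hk => by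
    rw [Finset.mem_Icc] at hk
    exact ⟨k - 1, by omega, by omega⟩
  have mem : ∀ m < n, m + 1 ∈ Finset.Icc 1 n := fun m hm => Finset.mem_Icc.2 ⟨by omega, hm⟩
  refine ⟨⟨fun k hk => ?_, fun k hk l hl => ?_, fun M _ _ hP hM => ?_⟩,
    ⟨fun k hk => ?_, fun k hk l hl => ?_, fun M _ _ hM => ?_⟩, fun k hk l _ => ?_⟩
  · obtain ⟨m, rfl, h⟩ := index k hk
    exact ⟨NDF.projective_P h, NDF.isIndecomposable_P h⟩
  · obtain ⟨m, rfl, h⟩ := index k hk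
    obtain ⟨l, rfl, h'⟩ := index l hl
    rintro ⟨e⟩
    rw [NDF.eq_of_P_equiv h h' e]
  · obtain ⟨m, hm, e⟩ := NDF.exists_equiv_P hn M hM
    exact ⟨m + 1, mem m hm, e⟩
  · obtain ⟨m, rfl, h⟩ := index k hk
    exact NDF.isSimpleModule_S h
  · obtain ⟨m, rfl, h⟩ := index k hk
    obtain ⟨l, rfl, h'⟩ := index l hl
    rintro ⟨e⟩
    rw [NDF.eq_of_S_equiv h h' e]
  · obtain ⟨m, hm, e⟩ := NDF.exists_equiv_S hn M
    exact ⟨m + 1, mem m hm, e⟩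
  · obtain ⟨m, rfl, h⟩ := index k hk
    exact NDF.rank_hom h
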